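/- Let $k \ge 1$ be an integer and let $x, y$ be nonzero real numbers. Let $\zeta(s)=\sum_{n\ge1} n^{-s}$ be the Riemann zeta function and $\bar\zeta(s) = \sum_{n \ge 1} (-1)^{n-1} n^{-s}$ the alternating zeta function. Then the two series below converge (as limits of partial sums; for $k=1$ the second one converges only conditionally) and $$\begin{aligned} &x^{2k-1}y\sum_{n=1}^\infty \frac{\pi}{n^{2k-1}\sinh\left(\frac{\pi n y}{x}\right)} + (-1)^k\, y^{2k-1}x \sum_{n=1}^\infty \frac{(-1)^n\,\pi\coth\left(\frac{\pi n x}{y}\right)}{n^{2k-1}} \\ &\quad = x^{2k}\zeta(2k) - (-1)^k y^{2k}\,\bar\zeta(2k) + 2\sum_{\substack{k_1+k_2=k\\ k_1,k_2\ge 1}} (-1)^{k_2} x^{2k_1}y^{2k_2}\,\zeta(2k_1)\,\bar\zeta(2k_2). \end{aligned}$$ -/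

import Mathlib

/-- The hyperbolic cotangent `coth t = cosh t / sinh t` of a real number `t ≠ 0`. -/
noncomputable def realCoth (t : ℝ) : ℝ := Real.cosh t / Real.sinh t

/-- The alternating Riemann zeta function: the sum of the series
`∑_{n ≥ 1} (-1)^(n-1) / n^s`, as the limit of its partial sums
(so that conditional convergence, as at `s = 1`, is allowed). -/
noncomputable def altZeta (s : ℂ) : ℂ :=
  Filter.limUnder Filter.atTop
    (fun N : ℕ => ∑ n ∈ Finset.Icc 1 N, (-1 : ℂ) ^ (n - 1) / (n : ℂ) ^ s)

open Filter Topology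

/-! Partial fractions turn both series into sums over `m, n ≥ 1` of `(-1)^m / (m²x² + n²y²)`,
weighted by `n^(-2(k-1))` for `1/sinh` and by `m^(-2(k-1))` for `coth`; the polar terms give the
`ζ(2k)` and `ζ̄(2k)` summands. For fixed `m, n`, a finite geometric sum in `x²/n²` and `-y²/m²`
(`lattice_term_identity`) collapses the combination of the two weights to the products `ζ(2k₁)
ζ̄(2k₂)`.

The `coth` series sums over `n` first, and for `k = 1` the double series is not absolutely
convergent. `tendsto_sum_alternating_tsum` justifies the exchange: partial alternating sums in `m`
are dominated by the `m = 1` term, which is summable in `n`. -/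

theorem sum_Icc_one_eq_sum_range {M : Type*} [AddCommMonoid M] (f : ℕ → M) (N : ℕ) :
    ∑ n ∈ Finset.Icc 1 N, f n = ∑ n ∈ Finset.range N, f (n + 1) := by
  rw [Finset.range_eq_Ico, Finset.sum_Ico_add', zero_add]
  rfl

/-! ### Partial fractions of `coth` and `1/sinh` -/

theorem ofReal_mul_I_mem_integerComplement {a : ℝ} (ha : a ≠ 0) :
    (a : ℂ) * Complex.I ∈ Complex.integerComplement := by
  rw [Complex.mem_integerComplement_iff]
  rintro ⟨n, hn⟩
  have := congrArg Complex.im hn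
  simp at this
  exact ha this.symm

/-- The Mittag-Leffler expansion of `π cot(πz)` at `z = ia`. -/
theorem hasSum_one_div_sq_add_sq {a : ℝ} (ha : a ≠ 0) :
    HasSum (fun m : ℕ => 1 / (((m : ℝ) + 1) ^ 2 + a ^ 2))
      ((Real.pi * realCoth (Real.pi * a) - 1 / a) / (2 * a)) := by
  have hz := ofReal_mul_I_mem_integerComplement ha
  have haC : (a : ℂ) ≠ 0 := by exact_mod_cast ha
  have hsum := (summable_cotTerm hz).hasSum
  have hval : ∑' n : ℕ, cotTerm (a * Complex.I) n =
      Real.pi * Complex.cot (Real.pi * (a * Complex.I)) - 1 / (a * Complex.I) :=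
    (cot_series_rep' hz).symm
  rw [hval] at hsum
  have hsum' := hsum.mul_left (Complex.I / (2 * a))
  rw [← Complex.hasSum_ofReal]
  have hsinh : (Real.sinh (Real.pi * a) : ℂ) ≠ 0 := by
    rw [Complex.ofReal_ne_zero, Real.sinh_ne_zero]
    exact mul_ne_zero Real.pi_ne_zero ha
  suffices hv : ((((Real.pi * realCoth (Real.pi * a) - 1 / a) / (2 * a) : ℝ)) : ℂ) =
      Complex.I / (2 * a) * (Real.pi * Complex.cot (Real.pi * (a * Complex.I))
        - 1 / (a * Complex.I)) by
    rw [hv]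
    refine hsum'.congr_fun fun m => ?_
    have h1 : (a : ℂ) * Complex.I - (m + 1) ≠ 0 := fun h => by
      have := congrArg Complex.im h
      simp at this
      exact ha this
    have h2 : (a : ℂ) * Complex.I + (m + 1) ≠ 0 := fun h => by
      have := congrArg Complex.im h
      simp at this
      exact ha this
    have h3 : ((m : ℂ) + 1) ^ 2 + (a : ℂ) ^ 2 ≠ 0 := by
      have : ((m : ℝ) + 1) ^ 2 + a ^ 2 ≠ 0 := by positivity
      exact_mod_cast this
    have h4 : ((a : ℂ) * Complex.I - (m + 1)) * ((a : ℂ) * Complex.I + (m + 1)) =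
        -(((m : ℂ) + 1) ^ 2 + (a : ℂ) ^ 2) := by
      linear_combination (a : ℂ) ^ 2 * Complex.I_sq
    simp only [cotTerm]
    rw [one_div_add_one_div h1 h2, h4]
    push_cast
    field_simp
    linear_combination (2 * a : ℂ) * Complex.I_sq
  · have hcot : Complex.cot (Real.pi * (a * Complex.I)) =
        -Complex.I * (Real.cosh (Real.pi * a) / Real.sinh (Real.pi * a) : ℝ) := by
      rw [Complex.cot, ← mul_assoc, Complex.cos_mul_I, Complex.sin_mul_I]
      push_cast
      push_cast at hsinh
      field_simp
      linear_combination (Complex.cosh (Real.pi * a)) * Complex.I_sq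
    rw [hcot, realCoth]
    push_cast
    push_cast at hsinh
    field_simp
    linear_combination ((Real.pi : ℂ) * a * Complex.cosh (Real.pi * a)) * Complex.I_sq

theorem one_div_sinh_eq {t : ℝ} (ht : t ≠ 0) :
    1 / Real.sinh t = realCoth (t / 2) - realCoth t := by
  have h2 : t / 2 ≠ 0 := div_ne_zero ht two_ne_zero
  have hs : Real.sinh (t / 2) ≠ 0 := by rwa [Real.sinh_ne_zero]
  have hc := (Real.cosh_pos (t / 2)).ne'
  obtain ⟨u, rfl⟩ : ∃ u, t = 2 * u := ⟨t / 2, by ring⟩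
  rw [mul_div_cancel_left₀ u two_ne_zero] at *
  rw [realCoth, realCoth, Real.sinh_two_mul, Real.cosh_two_mul]
  field_simp
  linear_combination (-1 : ℝ) * Real.cosh_sq_sub_sinh_sq u

theorem hasSum_alternating_one_div_sq_add_sq {a : ℝ} (ha : a ≠ 0) :
    HasSum (fun m : ℕ => (-1) ^ (m + 1) * (1 / (((m : ℝ) + 1) ^ 2 + a ^ 2)))
      ((Real.pi / Real.sinh (Real.pi * a) - 1 / a) / (2 * a)) := by
  set F : ℕ → ℝ := fun m => 1 / (((m : ℝ) + 1) ^ 2 + a ^ 2)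
  have hS := hasSum_one_div_sq_add_sq ha
  -- Index `2k+1` stands for the even integer `2(k+1)`; halving it rescales `a` to `a/2` and leaves
  -- a factor `1/4`.
  have hodd : HasSum (fun k => F (2 * k + 1))
      ((1 / 4) * ((Real.pi * realCoth (Real.pi * (a / 2)) - 1 / (a / 2)) / (2 * (a / 2)))) := by
    refine ((hasSum_one_div_sq_add_sq (div_ne_zero ha two_ne_zero)).mul_left
      (1 / 4)).congr_fun fun m => ?_
    change 1 / ((((2 * m + 1 : ℕ) : ℝ) + 1) ^ 2 + a ^ 2) = _
    have h1 : ((m : ℝ) + 1) ^ 2 + (a / 2) ^ 2 ≠ 0 := by positivity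
    have h2 : (((2 * m + 1 : ℕ) : ℝ) + 1) ^ 2 + a ^ 2 ≠ 0 := by positivity
    rw [div_mul_div_comm, div_eq_div_iff h2 (mul_ne_zero four_ne_zero h1)]
    push_cast
    ring
  have heven := (hS.summable.comp_injective
    (i := fun k : ℕ => 2 * k) (fun _ _ h => by simpa using h)).hasSum
  have htot := (heven.even_add_odd hodd).unique hS
  have hE : HasSum (fun k => (-1) ^ (2 * k + 1) * F (2 * k)) _ :=
    heven.neg.congr_fun (fun k => by simp [pow_succ, pow_mul, F])
  have hO : HasSum (fun k => (-1) ^ (2 * k + 1 + 1) * F (2 * k + 1)) _ :=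
    hodd.congr_fun (fun k => by simp [pow_succ, pow_mul])
  convert HasSum.even_add_odd (f := fun m => (-1) ^ (m + 1) * F m) hE hO using 1
  -- The signed sum is twice the odd-index part minus the total, hence a difference of `coth` at
  -- `πa/2` and `πa`.
  have hs := one_div_sinh_eq (mul_ne_zero Real.pi_ne_zero ha)
  rw [div_eq_mul_one_div Real.pi, hs, eq_sub_of_add_eq htot, mul_div_assoc Real.pi a 2]
  field_simp
  ring

/-! ### Alternating and geometric sums -/

/-- Peeling off the first term leaves `g 0` minus an alternating sum of the shifted sequence, which
lies in `[0, g 1]`. -/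
theorem alternating_sum_mem_Icc {g : ℕ → ℝ} (hg : Antitone g) (h0 : ∀ m, 0 ≤ g m) (M : ℕ) :
    ∑ m ∈ Finset.range M, (-1) ^ m * g m ∈ Set.Icc 0 (g 0) := by
  induction M generalizing g with
  | zero => simpa using h0 0
  | succ M ih =>
    have h := ih (g := fun m => g (m + 1)) (fun a b hab => hg (by lia)) (fun m => h0 _)
    rw [Finset.sum_range_succ']
    have h1 : ∑ m ∈ Finset.range M, (-1) ^ (m + 1) * g (m + 1) =
        -∑ m ∈ Finset.range M, (-1) ^ m * g (m + 1) := by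
      rw [← Finset.sum_neg_distrib]
      exact Finset.sum_congr rfl fun m _ => by ring
    have h2 := hg (zero_le_one)
    rw [h1]
    simp only [zero_add] at h
    constructor <;> simp <;> linarith [h.1, h.2]

theorem sum_antidiagonal_pos_pos_mul_sub {R : Type*} [CommRing R] (v w : R) (j : ℕ) :
    (∑ p ∈ (Finset.HasAntidiagonal.antidiagonal (j + 1)).filter (fun p => 1 ≤ p.1 ∧ 1 ≤ p.2),
      v ^ p.1 * w ^ p.2) * (v - w) = v * w * (v ^ j - w ^ j) := by
  rw [Finset.sum_filter, Finset.Nat.sum_antidiagonal_eq_sum_range_succ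
    (fun a b => if 1 ≤ a ∧ 1 ≤ b then v ^ a * w ^ b else 0), Finset.sum_range_succ,
    Finset.sum_range_succ', ← Commute.geom_sum₂_mul (Commute.all v w), ← mul_assoc,
    Finset.mul_sum]
  have h0 : ¬(1 ≤ j + 1 ∧ 1 ≤ j + 1 - (j + 1)) := by lia
  have h1 : ¬(1 ≤ 0 ∧ 1 ≤ j + 1 - 0) := by lia
  rw [if_neg h0, if_neg h1, add_zero, add_zero]
  congr 1
  refine Finset.sum_congr rfl fun i hi => ?_
  rw [Finset.mem_range] at hi
  obtain ⟨d, rfl⟩ := Nat.exists_eq_add_of_lt hi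
  rw [if_pos (by lia), show i + d + 1 + 1 - (i + 1) = d + 1 by lia,
    show i + d + 1 - 1 - i = d by lia]
  ring

/-! ### Zeta values as real series -/

theorem summable_one_div_nat_succ_pow {p : ℕ} (hp : 1 ≤ p) :
    Summable fun n : ℕ => 1 / ((n : ℝ) + 1) ^ (2 * p) := by
  have := (summable_nat_add_iff 1).2 (Real.summable_one_div_nat_pow.2 (show 1 < 2 * p by lia))
  simpa using this

theorem riemannZeta_two_mul_nat_eq_ofReal_tsum {p : ℕ} (hp : 1 ≤ p) :
    riemannZeta (2 * p) = ((∑' n : ℕ, 1 / ((n : ℝ) + 1) ^ (2 * p) : ℝ) : ℂ) := by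
  have h := zeta_nat_eq_tsum_of_gt_one (show 1 < 2 * p by lia)
  have hs : Summable fun n : ℕ => 1 / (n : ℂ) ^ (2 * p) := by
    have := Complex.summable_ofReal.2
      (Real.summable_one_div_nat_pow.2 (show 1 < 2 * p by lia))
    simpa using this
  rw [hs.tsum_eq_zero_add] at h
  push_cast at h ⊢
  rw [h]
  simp [show p ≠ 0 by lia]

theorem summable_alternating_one_div_nat_succ_pow {p : ℕ} (hp : 1 ≤ p) :
    Summable fun m : ℕ => (-1 : ℝ) ^ m * (1 / ((m : ℝ) + 1) ^ (2 * p)) := by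
  refine (summable_one_div_nat_succ_pow hp).of_norm_bounded fun m => ?_
  rw [norm_mul, norm_pow, norm_neg, norm_one, one_pow, one_mul, Real.norm_of_nonneg (by positivity)]

theorem altZeta_two_mul_nat_eq_ofReal_tsum {p : ℕ} (hp : 1 ≤ p) :
    altZeta (2 * p) = ((∑' m : ℕ, (-1 : ℝ) ^ m * (1 / ((m : ℝ) + 1) ^ (2 * p)) : ℝ) : ℂ) := by
  refine Tendsto.limUnder_eq ?_
  have h := (Complex.hasSum_ofReal.2
    (summable_alternating_one_div_nat_succ_pow hp).hasSum).tendsto_sum_nat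
  refine h.congr fun N => ?_
  rw [sum_Icc_one_eq_sum_range]
  refine Finset.sum_congr rfl fun m _ => ?_
  rw [show (2 * p : ℂ) = ((2 * p : ℕ) : ℂ) by push_cast; rfl, Complex.cpow_natCast]
  push_cast
  simp [div_eq_mul_inv]

/-! ### Lattice sums -/

theorem hasSum_one_div_lattice {x y c : ℝ} (hx : x ≠ 0) (hy : y ≠ 0) (hc : 0 < c) :
    HasSum (fun n : ℕ => 1 / (c ^ 2 * x ^ 2 + ((n : ℝ) + 1) ^ 2 * y ^ 2))
      ((Real.pi * realCoth (Real.pi * c * x / y) - y / (c * x)) / (2 * c * x * y)) := by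
  have ha : c * x / y ≠ 0 := div_ne_zero (mul_ne_zero hc.ne' hx) hy
  have hv : (Real.pi * realCoth (Real.pi * c * x / y) - y / (c * x)) / (2 * c * x * y) =
      1 / y ^ 2 * ((Real.pi * realCoth (Real.pi * (c * x / y)) - 1 / (c * x / y)) /
        (2 * (c * x / y))) := by
    rw [show Real.pi * c * x / y = Real.pi * (c * x / y) by ring]
    field_simp
  rw [hv]
  refine ((hasSum_one_div_sq_add_sq ha).mul_left (1 / y ^ 2)).congr_fun fun n => ?_
  have : ((n : ℝ) + 1) ^ 2 + (c * x / y) ^ 2 = (c ^ 2 * x ^ 2 + (n + 1) ^ 2 * y ^ 2) / y ^ 2 := by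
    field_simp
    ring
  rw [this]
  field_simp

theorem hasSum_alternating_one_div_lattice {x y c : ℝ} (hx : x ≠ 0) (hy : y ≠ 0) (hc : 0 < c) :
    HasSum (fun m : ℕ => (-1) ^ (m + 1) * (1 / (((m : ℝ) + 1) ^ 2 * x ^ 2 + c ^ 2 * y ^ 2)))
      ((Real.pi / Real.sinh (Real.pi * c * y / x) - x / (c * y)) / (2 * c * x * y)) := by
  have ha : c * y / x ≠ 0 := div_ne_zero (mul_ne_zero hc.ne' hy) hx
  have hv : (Real.pi / Real.sinh (Real.pi * c * y / x) - x / (c * y)) / (2 * c * x * y) =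
      1 / x ^ 2 * ((Real.pi / Real.sinh (Real.pi * (c * y / x)) - 1 / (c * y / x)) /
        (2 * (c * y / x))) := by
    rw [show Real.pi * c * y / x = Real.pi * (c * y / x) by ring]
    field_simp
  rw [hv]
  refine ((hasSum_alternating_one_div_sq_add_sq ha).mul_left (1 / x ^ 2)).congr_fun fun m => ?_
  have : ((m : ℝ) + 1) ^ 2 + (c * y / x) ^ 2 = ((m + 1) ^ 2 * x ^ 2 + c ^ 2 * y ^ 2) / x ^ 2 := by
    field_simp
  rw [this]
  field_simp

/-- Interchange of summation for an alternating double series whose terms decrease in the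
alternating variable and whose leading row is summable. -/
theorem tendsto_sum_alternating_tsum {g : ℕ → ℕ → ℝ} (hanti : ∀ n, Antitone fun m => g m n)
    (h0 : ∀ m n, 0 ≤ g m n) (hrow : ∀ m, Summable (g m)) (hcol : ∀ n, Summable fun m => g m n) :
    Summable (fun n => ∑' m, (-1) ^ m * g m n) ∧
    Tendsto (fun M => ∑ m ∈ Finset.range M, (-1) ^ m * ∑' n, g m n) atTop
      (𝓝 (∑' n, ∑' m, (-1) ^ m * g m n)) := by
  have hbound (M n : ℕ) : ‖∑ m ∈ Finset.range M, (-1) ^ m * g m n‖ ≤ g 0 n := by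
    have h := alternating_sum_mem_Icc (hanti n) (fun m => h0 m n) M
    rw [Real.norm_of_nonneg h.1]
    exact h.2
  have hlim (n : ℕ) : Tendsto (fun M => ∑ m ∈ Finset.range M, (-1) ^ m * g m n) atTop
      (𝓝 (∑' m, (-1) ^ m * g m n)) := by
    refine (((hcol n).of_norm_bounded fun m => ?_).hasSum).tendsto_sum_nat
    rw [norm_mul, norm_pow, norm_neg, norm_one, one_pow, one_mul, Real.norm_of_nonneg (h0 m n)]
  refine ⟨(hrow 0).of_norm_bounded fun n =>
    le_of_tendsto (hlim n).norm (Eventually.of_forall fun M => hbound M n), ?_⟩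
  refine (tendsto_tsum_of_dominated_convergence (hrow 0) hlim
    (Eventually.of_forall hbound)).congr fun M => ?_
  rw [Summable.tsum_finsetSum fun m _ => (hrow m).mul_left _]
  exact Finset.sum_congr rfl fun m _ => tsum_mul_left

/-- With `v = x²/a²` and `w = -y²/b²`, the difference `v - w` is the lattice denominator over
`a²b²`, so dividing the geometric sum by it gives the left side up to sign. -/
theorem lattice_term_identity {x y a b : ℝ} (hx : x ≠ 0) (ha : 0 < a) (hb : 0 < b) (j : ℕ) :
    x ^ (2 * (j + 1)) * y ^ 2 / a ^ (2 * j) * (1 / (b ^ 2 * x ^ 2 + a ^ 2 * y ^ 2))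
      + (-1) ^ (j + 1) * y ^ (2 * (j + 1)) * x ^ 2 / b ^ (2 * j) *
        (1 / (b ^ 2 * x ^ 2 + a ^ 2 * y ^ 2)) =
    -∑ p ∈ (Finset.HasAntidiagonal.antidiagonal (j + 1)).filter (fun p => 1 ≤ p.1 ∧ 1 ≤ p.2),
      (-1) ^ p.2 * x ^ (2 * p.1) * y ^ (2 * p.2) * (1 / a ^ (2 * p.1)) * (1 / b ^ (2 * p.2)) := by
  have hd : b ^ 2 * x ^ 2 + a ^ 2 * y ^ 2 ≠ 0 := by positivity
  have h := sum_antidiagonal_pos_pos_mul_sub (x ^ 2 / a ^ 2) (-(y ^ 2 / b ^ 2)) j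
  have hvw : x ^ 2 / a ^ 2 - -(y ^ 2 / b ^ 2) =
      (b ^ 2 * x ^ 2 + a ^ 2 * y ^ 2) / (a ^ 2 * b ^ 2) := by
    field_simp
    ring
  have hne : (b ^ 2 * x ^ 2 + a ^ 2 * y ^ 2) / (a ^ 2 * b ^ 2) ≠ 0 := by positivity
  rw [hvw, ← eq_div_iff hne] at h
  have hterm : ∀ p : ℕ × ℕ, (-1) ^ p.2 * x ^ (2 * p.1) * y ^ (2 * p.2) * (1 / a ^ (2 * p.1)) *
      (1 / b ^ (2 * p.2)) = (x ^ 2 / a ^ 2) ^ p.1 * (-(y ^ 2 / b ^ 2)) ^ p.2 := fun p => by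
    rw [neg_pow (y ^ 2 / b ^ 2), div_pow, div_pow]
    simp only [← pow_mul]
    ring
  rw [Finset.sum_congr rfl fun p _ => hterm p, h, neg_pow (y ^ 2 / b ^ 2), div_pow, div_pow]
  simp only [← pow_mul]
  field_simp
  ring

/-- The termwise identity summed over `m` with signs, for one fixed `a = n`. -/
theorem tsum_lattice_combination {x y a : ℝ} (hx : x ≠ 0) (ha : 0 < a) (j : ℕ)
    {g : ℕ → ℝ} (hg : g = fun m : ℕ => 1 / (((m : ℝ) + 1) ^ 2 * x ^ 2 + a ^ 2 * y ^ 2))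
    (h1 : Summable fun m => (-1) ^ (m + 1) * g m)
    (h2 : Summable fun m : ℕ => (-1) ^ m * (g m / ((m : ℝ) + 1) ^ (2 * j))) :
    x ^ (2 * (j + 1)) * y ^ 2 * ((∑' m, (-1) ^ (m + 1) * g m) / a ^ (2 * j))
      - (-1) ^ (j + 1) * y ^ (2 * (j + 1)) * x ^ 2 *
        (∑' m : ℕ, (-1) ^ m * (g m / ((m : ℝ) + 1) ^ (2 * j))) =
    ∑ p ∈ (Finset.HasAntidiagonal.antidiagonal (j + 1)).filter (fun p => 1 ≤ p.1 ∧ 1 ≤ p.2),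
      (-1) ^ p.2 * x ^ (2 * p.1) * y ^ (2 * p.2) * (1 / a ^ (2 * p.1)) *
        ∑' m : ℕ, (-1 : ℝ) ^ m * (1 / ((m : ℝ) + 1) ^ (2 * p.2)) := by
  have hL := (h1.hasSum.mul_left (x ^ (2 * (j + 1)) * y ^ 2 / a ^ (2 * j))).sub
    (h2.hasSum.mul_left ((-1) ^ (j + 1) * y ^ (2 * (j + 1)) * x ^ 2))
  have hR := hasSum_sum (s := (Finset.HasAntidiagonal.antidiagonal (j + 1)).filter
    (fun p => 1 ≤ p.1 ∧ 1 ≤ p.2)) fun p hp =>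
      (summable_alternating_one_div_nat_succ_pow (Finset.mem_filter.1 hp).2.2).hasSum.mul_left
        ((-1) ^ p.2 * x ^ (2 * p.1) * y ^ (2 * p.2) * (1 / a ^ (2 * p.1)))
  rw [mul_div_assoc', mul_div_right_comm]
  refine hL.unique (hR.congr_fun fun m => ?_)
  have h := lattice_term_identity (y := y) hx ha (show (0 : ℝ) < (m : ℝ) + 1 by positivity) j
  rw [hg]
  simp only [mul_left_comm _ ((-1 : ℝ) ^ m), ← Finset.mul_sum]
  rw [eq_neg_iff_add_eq_zero, add_comm, ← eq_neg_iff_add_eq_zero] at h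
  rw [h]
  ring

theorem theorem2p3 (k : ℕ) (hk : 1 ≤ k) (x y : ℝ) (hx : x ≠ 0) (hy : y ≠ 0) :
    ∃ A B : ℝ,
      Filter.Tendsto
        (fun N : ℕ => ∑ n ∈ Finset.Icc 1 N,
          Real.pi / ((n : ℝ) ^ (2 * k - 1) * Real.sinh (Real.pi * n * y / x)))
        Filter.atTop (nhds A) ∧
      Filter.Tendsto
        (fun N : ℕ => ∑ n ∈ Finset.Icc 1 N,
          Real.pi * realCoth (Real.pi * n * x / y) / (n : ℝ) ^ (2 * k - 1) * (-1 : ℝ) ^ n)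
        Filter.atTop (nhds B) ∧
      ((A * x ^ (2 * k - 1) * y + (-1 : ℝ) ^ k * B * y ^ (2 * k - 1) * x : ℝ) : ℂ) =
        (x : ℂ) ^ (2 * k) * riemannZeta (2 * k)
          - (-1 : ℂ) ^ k * (y : ℂ) ^ (2 * k) * altZeta (2 * k)
          + 2 * ∑ p ∈ (Finset.HasAntidiagonal.antidiagonal k).filter (fun p => 1 ≤ p.1 ∧ 1 ≤ p.2),
              (-1 : ℂ) ^ p.2 * (x : ℂ) ^ (2 * p.1) * (y : ℂ) ^ (2 * p.2)
                * riemannZeta (2 * p.1) * altZeta (2 * p.2) := by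
  obtain ⟨j, rfl⟩ : ∃ j, k = j + 1 := ⟨k - 1, by lia⟩
  set f : ℕ → ℕ → ℝ := fun m n => 1 / (((m : ℝ) + 1) ^ 2 * x ^ 2 + ((n : ℝ) + 1) ^ 2 * y ^ 2)
    with hf
  set g : ℕ → ℕ → ℝ := fun m n => f m n / ((m : ℝ) + 1) ^ (2 * j) with hg
  set Z : ℕ → ℝ := fun p => ∑' n : ℕ, 1 / ((n : ℝ) + 1) ^ (2 * p) with hZ
  set E : ℕ → ℝ := fun p => ∑' m : ℕ, (-1 : ℝ) ^ m * (1 / ((m : ℝ) + 1) ^ (2 * p)) with hE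
  have hpos (m : ℕ) : (0 : ℝ) < (m : ℝ) + 1 := by positivity
  have hf0 (m n : ℕ) : 0 ≤ f m n := by simp only [hf]; positivity
  have hg0 (m n : ℕ) : 0 ≤ g m n := by simp only [hg, hf]; positivity
  have hrow (m : ℕ) := hasSum_one_div_lattice hx hy (hpos m)
  have hcol (n : ℕ) := hasSum_alternating_one_div_lattice hx hy (hpos n)
  have hfcol (n : ℕ) : Summable fun m => f m n :=
    (hasSum_one_div_lattice hy hx (hpos n)).summable.congr fun m => by simp only [hf, add_comm]
  have hgf (m n : ℕ) : g m n ≤ f m n :=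
    div_le_self (hf0 m n) (one_le_pow₀ (by linarith [(Nat.cast_nonneg m : (0 : ℝ) ≤ m)]))
  have hgcol (n : ℕ) : Summable fun m => g m n :=
    (hfcol n).of_nonneg_of_le (fun m => hg0 m n) fun m => hgf m n
  have hfanti (n : ℕ) : Antitone fun m => f m n := fun a b hab => by
    simp only [hf]
    gcongr
  have hganti (n : ℕ) : Antitone fun m => g m n := fun a b hab =>
    div_le_div₀ (hf0 a n) (hfanti n hab) (by positivity) (by gcongr)
  -- For the `1/sinh` series the inner sum is already over `m`, so only summability in `n` is
  -- needed; the exchange of order is needed for `g` alone.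
  obtain ⟨hs, -⟩ := tendsto_sum_alternating_tsum hfanti hf0 (fun m => (hrow m).summable) hfcol
  obtain ⟨ht, hB⟩ := tendsto_sum_alternating_tsum hganti hg0
    (fun m => (hrow m).summable.div_const _) hgcol
  set s : ℕ → ℝ := fun n => (∑' m, (-1) ^ (m + 1) * f m n) / ((n : ℝ) + 1) ^ (2 * j) with hsdef
  set t : ℕ → ℝ := fun n => ∑' m, (-1) ^ m * g m n
  have hs' : Summable s := by
    refine hs.norm.of_norm_bounded fun n => ?_
    have h1 : ∑' m, (-1) ^ (m + 1) * f m n = -∑' m, (-1) ^ m * f m n := by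
      rw [← tsum_neg]
      exact tsum_congr fun m => by ring
    simp only [hsdef]
    rw [h1, norm_div, norm_neg, Real.norm_of_nonneg (pow_nonneg (hpos n).le _)]
    exact div_le_self (norm_nonneg _)
      (one_le_pow₀ (by linarith [(Nat.cast_nonneg n : (0 : ℝ) ≤ n)]))
  have hA := (((summable_one_div_nat_succ_pow (show 1 ≤ j + 1 by lia)).hasSum.mul_left
    (x / y)).add (hs'.hasSum.mul_left (2 * x * y))).tendsto_sum_nat
  have hB' := (((summable_alternating_one_div_nat_succ_pow
    (show 1 ≤ j + 1 by lia)).hasSum.mul_left (y / x)).tendsto_sum_nat.add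
      (hB.const_mul (2 * x * y))).neg
  refine ⟨_, _, hA.congr fun N => ?_, hB'.congr fun N => ?_, ?_⟩
  · rw [sum_Icc_one_eq_sum_range]
    refine Finset.sum_congr rfl fun n _ => ?_
    have := (hpos n).ne'
    simp only [hsdef, hf]
    rw [(hcol n).tsum_eq, show 2 * (j + 1) - 1 = 2 * j + 1 by lia]
    push_cast
    field_simp
    ring
  · rw [sum_Icc_one_eq_sum_range, Finset.mul_sum, ← Finset.sum_add_distrib,
      ← Finset.sum_neg_distrib]
    refine Finset.sum_congr rfl fun m _ => ?_
    have := (hpos m).ne'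
    simp only [hg, hf]
    rw [tsum_div_const, (hrow m).tsum_eq, show 2 * (j + 1) - 1 = 2 * j + 1 by lia]
    push_cast
    field_simp
    ring
  -- Both sums now run over `n` outside and `m` inside, so they can be combined for each `n`
  -- separately.
  · have hmain : x ^ (2 * (j + 1)) * y ^ 2 * ∑' n, s n
        - (-1) ^ (j + 1) * y ^ (2 * (j + 1)) * x ^ 2 * ∑' n, t n =
        ∑ p ∈ (Finset.HasAntidiagonal.antidiagonal (j + 1)).filter (fun p => 1 ≤ p.1 ∧ 1 ≤ p.2),
          (-1) ^ p.2 * x ^ (2 * p.1) * y ^ (2 * p.2) * Z p.1 * E p.2 := by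
      have hL := (hs'.hasSum.mul_left (x ^ (2 * (j + 1)) * y ^ 2)).sub
        (ht.hasSum.mul_left ((-1) ^ (j + 1) * y ^ (2 * (j + 1)) * x ^ 2))
      have hR := hasSum_sum (s := (Finset.HasAntidiagonal.antidiagonal (j + 1)).filter
        (fun p => 1 ≤ p.1 ∧ 1 ≤ p.2)) fun p hp =>
          ((summable_one_div_nat_succ_pow (Finset.mem_filter.1 hp).2.1).hasSum.mul_left
            ((-1) ^ p.2 * x ^ (2 * p.1) * y ^ (2 * p.2))).mul_right (E p.2)
      refine hL.unique (hR.congr_fun fun n => ?_)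
      exact tsum_lattice_combination hx (hpos n) j rfl (hcol n).summable
        ((hgcol n).of_norm_bounded fun m => by
          rw [norm_mul, norm_pow, norm_neg, norm_one, one_pow, one_mul]
          exact (Real.norm_of_nonneg (hg0 m n)).le)
    have hsumC : ∑ p ∈ (Finset.HasAntidiagonal.antidiagonal (j + 1)).filter
        (fun p => 1 ≤ p.1 ∧ 1 ≤ p.2), (-1 : ℂ) ^ p.2 * (x : ℂ) ^ (2 * p.1) * (y : ℂ) ^ (2 * p.2)
          * riemannZeta (2 * p.1) * altZeta (2 * p.2) =
        ((∑ p ∈ (Finset.HasAntidiagonal.antidiagonal (j + 1)).filter (fun p => 1 ≤ p.1 ∧ 1 ≤ p.2),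
          (-1) ^ p.2 * x ^ (2 * p.1) * y ^ (2 * p.2) * Z p.1 * E p.2 : ℝ) : ℂ) := by
      rw [Complex.ofReal_sum]
      refine Finset.sum_congr rfl fun p hp => ?_
      rw [riemannZeta_two_mul_nat_eq_ofReal_tsum (Finset.mem_filter.1 hp).2.1,
        altZeta_two_mul_nat_eq_ofReal_tsum (Finset.mem_filter.1 hp).2.2]
      simp only [Complex.ofReal_mul, Complex.ofReal_pow, Complex.ofReal_neg, Complex.ofReal_one,
        hZ, hE]
    rw [hsumC, riemannZeta_two_mul_nat_eq_ofReal_tsum (show 1 ≤ j + 1 by lia),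
      altZeta_two_mul_nat_eq_ofReal_tsum (show 1 ≤ j + 1 by lia), ← hmain,
      show 2 * (j + 1) - 1 = 2 * j + 1 by lia]
    norm_cast
    field_simp
    ring
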